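/- For $0\le k<1$ let $K(k)=\int_0^{\pi/2}\frac{dt}{\sqrt{1-k^2\sin^2 t}}$ be the complete elliptic integral of the first kind with modulus $k$. For every real $r>0$ there is exactly one $k_r\in(0,1)$ such that $\frac{K(k_r')}{K(k_r)}=\sqrt{r}$, where $k_r'=\sqrt{1-k_r^2}$. With this $k_r$, and $K=K(k_r)$, the series below converges absolutely and $$\sum_{n=0}^{\infty}\frac{(-1)^n}{e^{(2n+1)\pi\sqrt{r}}+1}=\frac14-\frac{K\,k_r'}{2\pi}.$$ -/

import Mathlib

/-- The complete elliptic integral of the first kind `K(k)` as a function of the modulus `k`. -/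
noncomputable def ellipticK (k : ℝ) : ℝ :=
  ∫ t in (0 : ℝ)..(Real.pi / 2), 1 / Real.sqrt (1 - k ^ 2 * Real.sin t ^ 2)

/-- The complementary modulus `k' = √(1 - k²)`. -/
noncomputable def complModulus (k : ℝ) : ℝ := Real.sqrt (1 - k ^ 2)

/-- `k` is the modulus `k_r` attached to `r`: it lies in `(0, 1)` and `K(k') / K(k) = √r`. -/
def IsSingularModulus (r k : ℝ) : Prop :=
  0 < k ∧ k < 1 ∧ ellipticK (complModulus k) / ellipticK k = Real.sqrt r

/-! Put s = √r and q = exp(-πs). Both sides equal (1 - θ₄(q)²)/4.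

For the elliptic side, the doubling formulas make (θ₃², θ₄²) at 2s the arithmetic and geometric
means of the pair at s. Gauss's integral is invariant under that step (`gaussIntegral_agm_step`),
and the pair tends to (1, 1), so the integral is π/2. Hence k = θ₂²/θ₃² has k' = θ₄²/θ₃² and K =
(π/2)θ₃², so that K k' = (π/2)θ₄². Poisson summation under s ↦ 1/s exchanges k and k', which gives
K(k')/K(k) = s; strict monotonicity of this ratio makes k unique.

For the series, a finite Jacobi triple product is differentiated in z and the limit taken
afterwards. At z = -1 this gives Jacobi's series for the cubed Euler product, and at z = q with base
q⁴ a Lambert series as logarithmic derivative. Together they express θ₄² as 1 minus four times the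
required sum (`tsum_alternating_sq_sq_eq_lambert`). -/

/-! ### Theta constants: doubling, Jacobi's quartic identity, inversion, limits. -/

section Theta

open Real Filter Topology

/-- Jacobi's `θ₂` at the nome `exp (-π s)`. -/
noncomputable def thetaTwo (s : ℝ) : ℝ := ∑' n : ℤ, rexp (-π * s * ((n : ℝ) + 1 / 2) ^ 2)

/-- Jacobi's `θ₃` at the nome `exp (-π s)`. -/
noncomputable def thetaThree (s : ℝ) : ℝ := ∑' n : ℤ, rexp (-π * s * (n : ℝ) ^ 2)

/-- Jacobi's `θ₄` at the nome `exp (-π s)`. -/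
noncomputable def thetaFour (s : ℝ) : ℝ :=
  ∑' n : ℤ, (-1 : ℝ) ^ n * rexp (-π * s * (n : ℝ) ^ 2)

theorem summable_exp_neg_mul_sq_add {s : ℝ} (hs : 0 < s) (b : ℝ) :
    Summable fun n : ℤ => rexp (-π * s * ((n : ℝ) + b) ^ 2) := by
  have h := summable_pow_mul_jacobiTheta₂_term_bound (|b| * s) hs 0
  refine Summable.of_nonneg_of_le (fun n => (exp_pos _).le) (fun n => ?_) h
  simp only [pow_zero, one_mul]
  apply exp_le_exp.mpr
  have h1 : -(|(n : ℝ)| * |b|) ≤ n * b := by rw [← abs_mul]; exact neg_abs_le _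
  have hps := mul_pos pi_pos hs
  push_cast
  nlinarith [mul_le_mul_of_nonneg_left h1 hps.le, mul_nonneg hps.le (sq_nonneg b)]

theorem summable_exp_neg_mul_sq {s : ℝ} (hs : 0 < s) :
    Summable fun n : ℤ => rexp (-π * s * (n : ℝ) ^ 2) := by
  simpa using summable_exp_neg_mul_sq_add hs 0

theorem summable_norm_alternating {f : ℤ → ℝ} (hf : Summable fun n => ‖f n‖) :
    Summable fun n => ‖(-1 : ℝ) ^ n * f n‖ := by
  simpa [abs_mul, abs_neg_one_zpow, norm_mul] using hf

/-- Splits ℤ² by the parity of m + n. In the new coordinates m² + n² becomes 2a² + 2b² or 2(a +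
1/2)² + 2(b + 1/2)², the source of all the doubling formulas. -/
theorem tsum_even_add_odd_lattice {f : ℤ × ℤ → ℝ} (hf : Summable f) :
    ∑' p, f p = ∑' p : ℤ × ℤ, f (p.1 + p.2, p.1 - p.2) +
      ∑' p : ℤ × ℤ, f (p.1 + p.2 + 1, p.1 - p.2) := by
  let g : (ℤ × ℤ) ⊕ (ℤ × ℤ) → ℤ × ℤ :=
    Sum.elim (fun p => (p.1 + p.2, p.1 - p.2)) (fun p => (p.1 + p.2 + 1, p.1 - p.2))
  have hg : Function.Bijective g := by
    constructor
    · rintro (⟨a, b⟩ | ⟨a, b⟩) (⟨c, d⟩ | ⟨c, d⟩) h <;>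
        simp only [g, Sum.elim_inl, Sum.elim_inr, Prod.mk.injEq] at h <;>
        simp only [Sum.inl.injEq, Sum.inr.injEq, Prod.mk.injEq, reduceCtorEq] <;> omega
    · rintro ⟨m, n⟩
      rcases Int.even_or_odd' (m + n) with ⟨c, hc | hc⟩
      · exact ⟨Sum.inl (c, m - c), by simp only [g, Sum.elim_inl, Prod.mk.injEq]; omega⟩
      · exact ⟨Sum.inr (c, m - c - 1), by simp only [g, Sum.elim_inr, Prod.mk.injEq]; omega⟩
  let e := Equiv.ofBijective g hg
  have h1 : Summable (f ∘ e) := e.summable_iff.mpr hf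
  rw [← e.tsum_eq f]
  exact Summable.tsum_sum (f := fun x => f (e x))
    (h1.comp_injective Sum.inl_injective) (h1.comp_injective Sum.inr_injective)

theorem tsum_mul_tsum_even_add_odd {f g : ℤ → ℝ} (hf : Summable fun n => ‖f n‖)
    (hg : Summable fun n => ‖g n‖) :
    (∑' n, f n) * ∑' n, g n = ∑' p : ℤ × ℤ, f (p.1 + p.2) * g (p.1 - p.2) +
      ∑' p : ℤ × ℤ, f (p.1 + p.2 + 1) * g (p.1 - p.2) := by
  rw [tsum_mul_tsum_of_summable_norm hf hg]
  exact tsum_even_add_odd_lattice (f := fun p => f p.1 * g p.2)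
    (summable_mul_of_summable_norm hf hg)

theorem thetaThree_sq_eq {s : ℝ} (hs : 0 < s) :
    thetaThree s ^ 2 = thetaThree (2 * s) ^ 2 + thetaTwo (2 * s) ^ 2 := by
  have h := (summable_exp_neg_mul_sq hs).norm
  have h3 := (summable_exp_neg_mul_sq (mul_pos two_pos hs)).norm
  have h2 := (summable_exp_neg_mul_sq_add (mul_pos two_pos hs) (1 / 2)).norm
  rw [sq, sq, sq, thetaThree, tsum_mul_tsum_even_add_odd h h, thetaThree, thetaTwo,
    tsum_mul_tsum_of_summable_norm h3 h3, tsum_mul_tsum_of_summable_norm h2 h2]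
  congr 1 <;> refine tsum_congr fun p => ?_ <;> rw [← exp_add, ← exp_add] <;> congr 1 <;>
    push_cast <;> ring

theorem neg_one_zpow_add_mul_sub (a b : ℤ) : (-1 : ℝ) ^ (a + b) * (-1) ^ (a - b) = 1 := by
  rw [← zpow_add₀ (by norm_num), show a + b + (a - b) = 2 * a by ring, zpow_mul]; norm_num

theorem neg_one_zpow_sub (a b : ℤ) : (-1 : ℝ) ^ (a - b) = (-1) ^ a * (-1) ^ b := by
  rw [zpow_sub₀ (by norm_num), div_eq_mul_inv, ← inv_zpow]; norm_num

/-- The sign (-1)^(m+n) is 1 on the even class of the lattice and -1 on the odd class. -/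
theorem thetaFour_sq_eq {s : ℝ} (hs : 0 < s) :
    thetaFour s ^ 2 = thetaThree (2 * s) ^ 2 - thetaTwo (2 * s) ^ 2 := by
  have h := summable_norm_alternating (summable_exp_neg_mul_sq hs).norm
  have h3 := (summable_exp_neg_mul_sq (mul_pos two_pos hs)).norm
  have h2 := (summable_exp_neg_mul_sq_add (mul_pos two_pos hs) (1 / 2)).norm
  rw [sq, sq, sq, thetaFour, tsum_mul_tsum_even_add_odd h h, thetaThree, thetaTwo,
    tsum_mul_tsum_of_summable_norm h3 h3, tsum_mul_tsum_of_summable_norm h2 h2, sub_eq_add_neg,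
    ← tsum_neg]
  congr 1 <;> refine tsum_congr fun p => ?_
  · rw [mul_mul_mul_comm, neg_one_zpow_add_mul_sub, one_mul, ← exp_add, ← exp_add]
    congr 1; push_cast; ring
  · rw [mul_mul_mul_comm, zpow_add_one₀ (by norm_num), mul_right_comm ((-1 : ℝ) ^ _),
      neg_one_zpow_add_mul_sub, one_mul, neg_one_mul, ← exp_add, ← exp_add]
    congr 2; push_cast; ring

/-- The reflection n ↦ -1 - n preserves (n + 1/2)² and reverses the sign. -/
theorem tsum_alternating_exp_half (s : ℝ) :
    ∑' n : ℤ, (-1 : ℝ) ^ n * rexp (-π * s * ((n : ℝ) + 1 / 2) ^ 2) = 0 := by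
  have h := (Equiv.subLeft (-1 : ℤ)).tsum_eq
    (fun n : ℤ => (-1 : ℝ) ^ n * rexp (-π * s * ((n : ℝ) + 1 / 2) ^ 2))
  have h2 : ∀ n : ℤ, (-1 : ℝ) ^ (Equiv.subLeft (-1 : ℤ) n) *
      rexp (-π * s * (((Equiv.subLeft (-1 : ℤ) n : ℤ) : ℝ) + 1 / 2) ^ 2) =
      -((-1 : ℝ) ^ n * rexp (-π * s * ((n : ℝ) + 1 / 2) ^ 2)) := by
    intro n
    rw [Equiv.subLeft_apply, neg_one_zpow_sub]
    have : -π * s * (((-1 - n : ℤ) : ℝ) + 1 / 2) ^ 2 = -π * s * ((n : ℝ) + 1 / 2) ^ 2 := by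
      push_cast; ring
    rw [this]; norm_num
  rw [tsum_congr h2, tsum_neg] at h
  linarith

/-- The sign (-1)^(a-b) factors as (-1)^a (-1)^b, so the odd class contributes the square of the
vanishing alternating half-integer series. -/
theorem thetaThree_mul_thetaFour {s : ℝ} (hs : 0 < s) :
    thetaThree s * thetaFour s = thetaFour (2 * s) ^ 2 := by
  have h := (summable_exp_neg_mul_sq hs).norm
  have h' := summable_norm_alternating h
  have h3 := summable_norm_alternating (summable_exp_neg_mul_sq (mul_pos two_pos hs)).norm
  have h2 := summable_norm_alternating
    (summable_exp_neg_mul_sq_add (mul_pos two_pos hs) (1 / 2)).norm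
  have h0 := tsum_mul_tsum_of_summable_norm h2 h2
  rw [tsum_alternating_exp_half, mul_zero] at h0
  rw [sq, thetaThree, thetaFour, thetaFour, tsum_mul_tsum_even_add_odd h h',
    tsum_mul_tsum_of_summable_norm h3 h3]
  conv_rhs => rw [← add_zero (tsum _), h0]
  congr 1 <;> refine tsum_congr fun p => ?_ <;>
    rw [mul_mul_mul_comm, ← neg_one_zpow_sub, mul_left_comm, ← exp_add, ← exp_add] <;>
    congr 2 <;> push_cast <;> ring

/-- Both doubling formulas at s/2 multiply to (θ₃² + θ₂²)(θ₃² - θ₂²), while θ₃θ₄ at s/2 is θ₄² at s.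
-/
theorem thetaThree_pow_four {s : ℝ} (hs : 0 < s) :
    thetaThree s ^ 4 = thetaTwo s ^ 4 + thetaFour s ^ 4 := by
  have hs2 : 0 < s / 2 := by positivity
  have e : 2 * (s / 2) = s := by ring
  have h1 := thetaThree_sq_eq hs2
  have h2 := thetaFour_sq_eq hs2
  have h3 := thetaThree_mul_thetaFour hs2
  rw [e] at h1 h2 h3
  have h4 : thetaFour s ^ 4 = thetaThree (s / 2) ^ 2 * thetaFour (s / 2) ^ 2 := by
    rw [← mul_pow, h3]; ring
  rw [h4, h1, h2]; ring

theorem thetaThree_inv {s : ℝ} (hs : 0 < s) : thetaThree (1 / s) = √s * thetaThree s := by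
  have h := Real.tsum_exp_neg_mul_int_sq hs
  have hs' : √s ≠ 0 := (sqrt_pos.mpr hs).ne'
  have e : ∀ n : ℤ, -π * (1 / s) * (n : ℝ) ^ 2 = -π / s * (n : ℝ) ^ 2 := fun n => by ring
  rw [thetaThree, thetaThree, h, ← sqrt_eq_rpow]
  simp_rw [e]
  field_simp

theorem thetaTwo_pos {s : ℝ} (hs : 0 < s) : 0 < thetaTwo s :=
  (summable_exp_neg_mul_sq_add hs (1 / 2)).tsum_pos (fun _ => (exp_pos _).le) 0 (exp_pos _)

theorem thetaThree_pos {s : ℝ} (hs : 0 < s) : 0 < thetaThree s :=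
  (summable_exp_neg_mul_sq hs).tsum_pos (fun _ => (exp_pos _).le) 0 (exp_pos _)

/-- Poisson summation: the character (-1)^n, entered as the linear term I/2, shifts the dual lattice
by -1/2. -/
theorem thetaFour_inv {s : ℝ} (hs : 0 < s) : thetaFour (1 / s) = √s * thetaTwo s := by
  have hs' : √s ≠ 0 := (sqrt_pos.mpr hs).ne'
  have h := Complex.tsum_exp_neg_quadratic (a := (1 / s : ℝ)) (by simpa using hs) (Complex.I / 2)
  have hl : ∀ n : ℤ, Complex.exp (-π * ((1 / s : ℝ) : ℂ) * n ^ 2 + 2 * π * (Complex.I / 2) * n) =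
      (((-1 : ℝ) ^ n * rexp (-π * (1 / s) * (n : ℝ) ^ 2) : ℝ) : ℂ) := by
    intro n
    rw [Complex.exp_add, show (2 * π * (Complex.I / 2) * n : ℂ) = n * (π * Complex.I) by ring,
      Complex.exp_int_mul, Complex.exp_pi_mul_I, mul_comm]
    push_cast; rfl
  have hr : ∀ n : ℤ, Complex.exp (-π / ((1 / s : ℝ) : ℂ) * (n + Complex.I * (Complex.I / 2)) ^ 2) =
      ((rexp (-π * s * (((n - 1 : ℤ) : ℝ) + 1 / 2) ^ 2) : ℝ) : ℂ) := by
    intro n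
    rw [← mul_div_assoc, Complex.I_mul_I]
    push_cast
    congr 1
    have : (s : ℂ) ≠ 0 := by exact_mod_cast hs.ne'
    field_simp
    ring
  rw [tsum_congr hl, tsum_congr hr, ← Complex.ofReal_tsum, ← Complex.ofReal_tsum,
    show ∑' n : ℤ, (-1 : ℝ) ^ n * rexp (-π * (1 / s) * (n : ℝ) ^ 2) = thetaFour (1 / s) from rfl,
    show ∑' n : ℤ, rexp (-π * s * (((n - 1 : ℤ) : ℝ) + 1 / 2) ^ 2) = thetaTwo s from
      (Equiv.subRight (1 : ℤ)).tsum_eq (fun n : ℤ => rexp (-π * s * ((n : ℝ) + 1 / 2) ^ 2)),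
    show (1 / 2 : ℂ) = ((1 / 2 : ℝ) : ℂ) by push_cast; rfl,
    ← Complex.ofReal_cpow (by positivity), ← sqrt_eq_rpow, sqrt_div zero_le_one, sqrt_one] at h
  have h' : thetaFour (1 / s) = 1 / (1 / √s) * thetaTwo s := by exact_mod_cast h
  simpa using h'

/-- The defining series alternates; inversion replaces it by the positive series of θ₂. -/
theorem thetaFour_pos {s : ℝ} (hs : 0 < s) : 0 < thetaFour s := by
  have h := thetaFour_inv (one_div_pos.mpr hs)
  rw [one_div_one_div] at h
  rw [h]
  exact mul_pos (sqrt_pos.mpr (one_div_pos.mpr hs)) (thetaTwo_pos (one_div_pos.mpr hs))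

theorem thetaFour_lt_thetaThree {s : ℝ} (hs : 0 < s) : thetaFour s < thetaThree s := by
  have h := thetaThree_pow_four hs
  exact lt_of_pow_lt_pow_left₀ 4 (thetaThree_pos hs).le
    (by linarith [pow_pos (thetaTwo_pos hs) 4])

theorem tendsto_tsum_mul_exp_atTop {c : ℤ → ℝ} (h0 : c 0 = 1) (hc : ∀ n, |c n| ≤ 1) :
    Tendsto (fun s : ℝ => ∑' n : ℤ, c n * rexp (-π * s * (n : ℝ) ^ 2)) atTop (𝓝 1) := by
  rw [← tsum_ite_eq (0 : ℤ) (fun _ => (1 : ℝ))]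
  refine tendsto_tsum_of_dominated_convergence (summable_exp_neg_mul_sq one_pos) (fun n => ?_) ?_
  · split_ifs with hn
    · simp [hn, h0]
    · have hn' : 0 < π * (n : ℝ) ^ 2 := by positivity
      have h := ((tendsto_exp_neg_atTop_nhds_zero.comp
        (tendsto_id.const_mul_atTop hn')).const_mul (c n))
      rw [mul_zero] at h
      refine h.congr fun s => ?_
      simp only [Function.comp, id]
      congr 2; ring
  · filter_upwards [eventually_ge_atTop 1] with s hs n
    rw [norm_mul, norm_of_nonneg (exp_pos _).le]
    refine (mul_le_of_le_one_left (exp_pos _).le (hc n)).trans (exp_le_exp.mpr ?_)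
    have : 0 ≤ π * (n : ℝ) ^ 2 := by positivity
    nlinarith

theorem tendsto_thetaThree_atTop : Tendsto thetaThree atTop (𝓝 1) := by
  refine (tendsto_tsum_mul_exp_atTop (c := fun _ => 1) rfl (by simp)).congr fun s => ?_
  simp only [one_mul]; rfl

theorem tendsto_thetaFour_atTop : Tendsto thetaFour atTop (𝓝 1) :=
  tendsto_tsum_mul_exp_atTop (c := fun n => (-1) ^ n) rfl fun n => (abs_neg_one_zpow n).le

end Theta

/-! ### Gauss's integral, the AGM, and K in terms of theta constants. -/

section EllipticIntegral

open Real Filter Topology MeasureTheory Set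

/-- Gauss's integral, `π / 2` over the arithmetic-geometric mean of `a` and `b`. -/
noncomputable def gaussIntegral (a b : ℝ) : ℝ :=
  ∫ t in (0 : ℝ)..(π / 2), 1 / √(a ^ 2 * cos t ^ 2 + b ^ 2 * sin t ^ 2)

theorem weighted_sin_cos_pos {a b : ℝ} (ha : 0 < a) (hb : 0 < b) (t : ℝ) :
    0 < a ^ 2 * cos t ^ 2 + b ^ 2 * sin t ^ 2 := by
  rcases eq_or_ne (cos t) 0 with h | h
  · have := sin_sq_add_cos_sq t
    rw [h] at this ⊢
    have h1 : sin t ^ 2 = 1 := by linarith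
    rw [h1]; positivity
  · positivity

theorem continuous_gaussIntegrand {a b : ℝ} (ha : 0 < a) (hb : 0 < b) :
    Continuous fun t : ℝ => 1 / √(a ^ 2 * cos t ^ 2 + b ^ 2 * sin t ^ 2) := by
  refine continuous_const.div (by fun_prop) fun t => ?_
  exact (sqrt_pos.mpr (weighted_sin_cos_pos ha hb t)).ne'

/-- Substitute x = b tan t. -/
theorem gaussIntegral_eq_integral_Ioi {a b : ℝ} (ha : 0 < a) (hb : 0 < b) :
    gaussIntegral a b = ∫ x in Ioi (0 : ℝ), 1 / √((x ^ 2 + a ^ 2) * (x ^ 2 + b ^ 2)) := by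
  have hpos : ∀ t ∈ Ioo 0 (π / 2), 0 < cos t := fun t ht =>
    cos_pos_of_mem_Ioo ⟨by linarith [ht.1, pi_pos], ht.2⟩
  have himg : (fun t => b * tan t) '' Ioo 0 (π / 2) = Ioi 0 := by
    ext x
    simp only [mem_image, mem_Ioi]
    constructor
    · rintro ⟨t, ht, rfl⟩
      exact mul_pos hb (tan_pos_of_pos_of_lt_pi_div_two ht.1 ht.2)
    · intro hx
      refine ⟨arctan (x / b), ⟨arctan_pos.mpr (div_pos hx hb), arctan_lt_pi_div_two _⟩, ?_⟩
      rw [tan_arctan]; field_simp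
  have hinj : InjOn (fun t => b * tan t) (Ioo 0 (π / 2)) := by
    intro t ht u hu h
    refine injOn_tan ⟨by linarith [ht.1, pi_pos], ht.2⟩ ⟨by linarith [hu.1, pi_pos], hu.2⟩ ?_
    exact mul_left_cancel₀ hb.ne' h
  rw [gaussIntegral, intervalIntegral.integral_of_le (by positivity), integral_Ioc_eq_integral_Ioo,
    ← himg, integral_image_eq_integral_abs_deriv_smul measurableSet_Ioo
      (fun t ht => ((hasDerivAt_tan (hpos t ht).ne').const_mul b).hasDerivWithinAt) hinj]
  refine setIntegral_congr_fun measurableSet_Ioo fun t ht => ?_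
  have hc := hpos t ht
  have h1 := weighted_sin_cos_pos ha hb t
  have e : ((b * tan t) ^ 2 + a ^ 2) * ((b * tan t) ^ 2 + b ^ 2) =
      (b / cos t ^ 2) ^ 2 * (a ^ 2 * cos t ^ 2 + b ^ 2 * sin t ^ 2) := by
    rw [tan_eq_sin_div_cos]
    have := sin_sq_add_cos_sq t
    field_simp
    rw [this]; ring
  simp only [smul_eq_mul]
  have h2 : 0 < b / cos t ^ 2 := by positivity
  rw [e, sqrt_mul (sq_nonneg _), sqrt_sq h2.le, mul_one_div b, abs_of_pos h2]
  have := (sqrt_pos.mpr h1).ne'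
  field_simp

theorem integral_eq_two_mul_gaussIntegral {a b : ℝ} (ha : 0 < a) (hb : 0 < b) :
    ∫ x : ℝ, 1 / √((x ^ 2 + a ^ 2) * (x ^ 2 + b ^ 2)) = 2 * gaussIntegral a b := by
  rw [gaussIntegral_eq_integral_Ioi ha hb,
    ← integral_comp_abs (f := fun x => 1 / √((x ^ 2 + a ^ 2) * (x ^ 2 + b ^ 2)))]
  simp only [sq_abs]

/-- Substitute y = (x - g²/x)/2, a bijection from (0, ∞) onto ℝ. Since g² = ab, both factors under
the root become rational expressions in x whose product is (x² + a²)(x² + b²) times a perfect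
square. -/
theorem gaussIntegral_agm_step {a b g : ℝ} (ha : 0 < a) (hb : 0 < b) (hg : 0 < g)
    (h : g ^ 2 = a * b) : gaussIntegral ((a + b) / 2) g = gaussIntegral a b := by
  have himg : (fun x => (x - g ^ 2 / x) / 2) '' Ioi 0 = univ := by
    refine eq_univ_of_forall fun y => ?_
    have hy : |y| < √(y ^ 2 + g ^ 2) := by
      rw [← sqrt_sq_eq_abs]; exact sqrt_lt_sqrt (sq_nonneg _) (by linarith [pow_pos hg 2])
    have hx : 0 < y + √(y ^ 2 + g ^ 2) := by linarith [neg_abs_le y]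
    -- The positive root of x² - 2yx - g² = 0.
    refine ⟨y + √(y ^ 2 + g ^ 2), hx, ?_⟩
    have := sq_sqrt (show 0 ≤ y ^ 2 + g ^ 2 by positivity)
    simp only
    field_simp
    nlinarith
  have hinj : InjOn (fun x => (x - g ^ 2 / x) / 2) (Ioi 0) := by
    intro x hx y hy hxy
    have hx' : 0 < x := hx
    have hy' : 0 < y := hy
    simp only at hxy
    field_simp at hxy
    have h0 : (x - y) * (x * y + g ^ 2) = 0 := by linarith
    have h1 : 0 < x * y + g ^ 2 := by positivity
    rcases mul_eq_zero.mp h0 with h2 | h2 <;> linarith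
  have hd : ∀ x ∈ Ioi (0 : ℝ), HasDerivWithinAt (fun x => (x - g ^ 2 / x) / 2)
      ((1 + g ^ 2 / x ^ 2) / 2) (Ioi 0) x := by
    intro x hx
    have hx' : x ≠ 0 := ne_of_gt hx
    have := (((hasDerivAt_id x).sub ((hasDerivAt_inv hx').const_mul (g ^ 2))).div_const 2)
    refine (this.congr_deriv ?_).hasDerivWithinAt
    field_simp; ring
  have h1 := integral_eq_two_mul_gaussIntegral (half_pos (add_pos ha hb)) hg
  rw [← setIntegral_univ, ← himg,
    integral_image_eq_integral_abs_deriv_smul measurableSet_Ioi hd hinj] at h1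
  have h2 : ∫ x in Ioi (0 : ℝ), |(1 + g ^ 2 / x ^ 2) / 2| •
      (1 / √((((x - g ^ 2 / x) / 2) ^ 2 + ((a + b) / 2) ^ 2) *
        (((x - g ^ 2 / x) / 2) ^ 2 + g ^ 2))) =
      ∫ x in Ioi (0 : ℝ), 2 * (1 / √((x ^ 2 + a ^ 2) * (x ^ 2 + b ^ 2))) := by
    refine setIntegral_congr_fun measurableSet_Ioi fun x hx => ?_
    have hx' : 0 < x := hx
    have e : (((x - g ^ 2 / x) / 2) ^ 2 + ((a + b) / 2) ^ 2) *
        (((x - g ^ 2 / x) / 2) ^ 2 + g ^ 2) =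
        ((x ^ 2 + g ^ 2) / (4 * x ^ 2)) ^ 2 * ((x ^ 2 + a ^ 2) * (x ^ 2 + b ^ 2)) := by
      have e1 : ((x - g ^ 2 / x) / 2) ^ 2 + g ^ 2 = ((x ^ 2 + g ^ 2) / (2 * x)) ^ 2 := by
        field_simp; ring
      have e2 : ((x - g ^ 2 / x) / 2) ^ 2 + ((a + b) / 2) ^ 2 =
          (x ^ 2 + a ^ 2) * (x ^ 2 + b ^ 2) / (4 * x ^ 2) := by
        rw [h]; field_simp; ring
      rw [e1, e2]; field_simp; ring
    have hs : √((x ^ 2 + a ^ 2) * (x ^ 2 + b ^ 2)) ≠ 0 := (sqrt_pos.mpr (by positivity)).ne'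
    simp only [smul_eq_mul]
    rw [e, sqrt_mul (sq_nonneg _), sqrt_sq (by positivity), abs_of_pos (by positivity)]
    field_simp
    ring
  rw [h2, integral_const_mul, ← gaussIntegral_eq_integral_Ioi ha hb] at h1
  linarith

theorem gaussIntegral_smul {a b c : ℝ} (hc : 0 < c) :
    gaussIntegral (c * a) (c * b) = gaussIntegral a b / c := by
  rw [gaussIntegral, gaussIntegral, ← intervalIntegral.integral_div]
  refine intervalIntegral.integral_congr fun t _ => ?_
  rw [show (c * a) ^ 2 * cos t ^ 2 + (c * b) ^ 2 * sin t ^ 2 =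
    c ^ 2 * (a ^ 2 * cos t ^ 2 + b ^ 2 * sin t ^ 2) by ring, sqrt_mul (sq_nonneg _),
    sqrt_sq hc.le, div_div, mul_comm]

theorem gaussIntegral_bounds {a b : ℝ} (hb : 0 < b) (hab : b ≤ a) :
    π / 2 / a ≤ gaussIntegral a b ∧ gaussIntegral a b ≤ π / 2 / b := by
  have ha := hb.trans_le hab
  have hc := (continuous_gaussIntegrand ha hb).intervalIntegrable (μ := volume) 0 (π / 2)
  have hi : ∀ c : ℝ, π / 2 / c = ∫ _ in (0 : ℝ)..(π / 2), 1 / c := fun c => by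
    simp [div_eq_mul_inv]
  have hsq : b ^ 2 ≤ a ^ 2 := by gcongr
  rw [hi a, hi b]
  constructor <;> refine intervalIntegral.integral_mono (by positivity) (by first | exact hc | simp)
    (by first | exact hc | simp) fun t => ?_ <;>
    refine one_div_le_one_div_of_le
      (by first | exact hb | exact sqrt_pos.mpr (weighted_sin_cos_pos ha hb t)) ?_
  · refine sqrt_le_iff.mpr ⟨ha.le, ?_⟩
    nlinarith [sin_sq_add_cos_sq t, sq_nonneg (sin t)]
  · refine le_sqrt_of_sq_le ?_
    nlinarith [sin_sq_add_cos_sq t, sq_nonneg (cos t)]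

/-- Doubling s is one AGM step, so the value is constant along 2ⁿs; there both arguments tend to 1
and the elementary bounds squeeze it to π/2. -/
theorem gaussIntegral_theta {s : ℝ} (hs : 0 < s) :
    gaussIntegral (thetaThree s ^ 2) (thetaFour s ^ 2) = π / 2 := by
  have step : ∀ s : ℝ, 0 < s → gaussIntegral (thetaThree (2 * s) ^ 2) (thetaFour (2 * s) ^ 2) =
      gaussIntegral (thetaThree s ^ 2) (thetaFour s ^ 2) := by
    intro s hs
    have h3 := thetaThree_pos hs
    have h4 := thetaFour_pos hs
    have e : thetaThree (2 * s) ^ 2 = (thetaThree s ^ 2 + thetaFour s ^ 2) / 2 := by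
      rw [thetaThree_sq_eq hs, thetaFour_sq_eq hs]; ring
    rw [e, ← thetaThree_mul_thetaFour hs]
    exact gaussIntegral_agm_step (by positivity) (by positivity) (by positivity) (by ring)
  have hn : ∀ n : ℕ, gaussIntegral (thetaThree (2 ^ n * s) ^ 2) (thetaFour (2 ^ n * s) ^ 2) =
      gaussIntegral (thetaThree s ^ 2) (thetaFour s ^ 2) := by
    intro n
    induction n with
    | zero => simp
    | succ n ih => rw [pow_succ' (2 : ℝ), mul_assoc, step _ (by positivity), ih]
  have ht : Tendsto (fun n : ℕ => (2 : ℝ) ^ n * s) atTop atTop :=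
    (tendsto_pow_atTop_atTop_of_one_lt one_lt_two).atTop_mul_const hs
  have hb : ∀ n : ℕ, _ := fun n : ℕ => gaussIntegral_bounds
    (pow_pos (thetaFour_pos (show 0 < 2 ^ n * s by positivity)) 2)
    (pow_le_pow_left₀ (thetaFour_pos (show 0 < 2 ^ n * s by positivity)).le
      (thetaFour_lt_thetaThree (show 0 < 2 ^ n * s by positivity)).le 2)
  simp only [hn] at hb
  have l3 := (tendsto_const_nhds (x := π / 2)).div ((tendsto_thetaThree_atTop.comp ht).pow 2)
    (by norm_num)
  have l4 := (tendsto_const_nhds (x := π / 2)).div ((tendsto_thetaFour_atTop.comp ht).pow 2)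
    (by norm_num)
  rw [one_pow, div_one] at l3 l4
  exact le_antisymm (ge_of_tendsto' l4 fun n => (hb n).2) (le_of_tendsto' l3 fun n => (hb n).1)

theorem ellipticK_eq_gaussIntegral {k : ℝ} (hk : k ^ 2 ≤ 1) :
    ellipticK k = gaussIntegral 1 (complModulus k) := by
  refine intervalIntegral.integral_congr fun t _ => ?_
  rw [complModulus, sq_sqrt (by linarith)]
  congr 2
  linarith [sin_sq_add_cos_sq t]

/-- Scaling (1, k') by θ₃² gives (θ₃², θ₄²). The hypothesis concerns only k', so that the lemma also
applies to the complementary modulus, with 1/s for s. -/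
theorem ellipticK_of_complModulus_eq {s k : ℝ} (hs : 0 < s) (hk : k ^ 2 ≤ 1)
    (h : complModulus k = thetaFour s ^ 2 / thetaThree s ^ 2) :
    ellipticK k = π / 2 * thetaThree s ^ 2 := by
  have h3 := thetaThree_pos hs
  have := gaussIntegral_smul (a := 1) (b := complModulus k) (pow_pos h3 2)
  rw [h, mul_one, mul_div_cancel₀ _ (by positivity), gaussIntegral_theta hs, ← h,
    ← ellipticK_eq_gaussIntegral hk] at this
  rw [this]; field_simp

/-- The modulus with nome `exp (-π s)`. -/
noncomputable def thetaModulus (s : ℝ) : ℝ := thetaTwo s ^ 2 / thetaThree s ^ 2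

theorem thetaModulus_pos {s : ℝ} (hs : 0 < s) : 0 < thetaModulus s :=
  div_pos (pow_pos (thetaTwo_pos hs) 2) (pow_pos (thetaThree_pos hs) 2)

theorem thetaModulus_sq_add {s : ℝ} (hs : 0 < s) :
    thetaModulus s ^ 2 + (thetaFour s ^ 2 / thetaThree s ^ 2) ^ 2 = 1 := by
  have h3 := thetaThree_pos hs
  have h := thetaThree_pow_four hs
  rw [thetaModulus]
  field_simp
  linarith

theorem thetaModulus_lt_one {s : ℝ} (hs : 0 < s) : thetaModulus s < 1 := by
  have h := thetaModulus_sq_add hs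
  have : 0 < (thetaFour s ^ 2 / thetaThree s ^ 2) ^ 2 :=
    pow_pos (div_pos (pow_pos (thetaFour_pos hs) 2) (pow_pos (thetaThree_pos hs) 2)) 2
  nlinarith

theorem complModulus_thetaModulus {s : ℝ} (hs : 0 < s) :
    complModulus (thetaModulus s) = thetaFour s ^ 2 / thetaThree s ^ 2 := by
  have h := thetaModulus_sq_add hs
  rw [complModulus, show 1 - thetaModulus s ^ 2 = (thetaFour s ^ 2 / thetaThree s ^ 2) ^ 2 by
    linarith]
  exact sqrt_sq (by positivity)

theorem ellipticK_thetaModulus {s : ℝ} (hs : 0 < s) :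
    ellipticK (thetaModulus s) = π / 2 * thetaThree s ^ 2 :=
  ellipticK_of_complModulus_eq hs (by nlinarith [thetaModulus_pos hs, thetaModulus_lt_one hs])
    (complModulus_thetaModulus hs)

theorem complModulus_complModulus {k : ℝ} (h0 : 0 ≤ k) (h1 : k ≤ 1) :
    complModulus (complModulus k) = k := by
  rw [complModulus, complModulus, sq_sqrt (by nlinarith), sub_sub_cancel, sqrt_sq h0]

/-- Inversion turns θ₄²/θ₃² at 1/s into θ₂²/θ₃² at s, so k' is the modulus attached to 1/s; the
factor s is that of θ₃(1/s)² = s θ₃(s)². -/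
theorem ellipticK_complModulus_thetaModulus {s : ℝ} (hs : 0 < s) :
    ellipticK (complModulus (thetaModulus s)) = s * ellipticK (thetaModulus s) := by
  have h0 := thetaModulus_pos hs
  have h1 := thetaModulus_lt_one hs
  have h3 := thetaThree_pos hs
  have hss := sq_sqrt hs.le
  rw [ellipticK_of_complModulus_eq (one_div_pos.mpr hs), ellipticK_thetaModulus hs,
    thetaThree_inv hs, mul_pow, hss]
  · ring
  · rw [complModulus, sq_sqrt (by nlinarith)]; nlinarith
  · rw [complModulus_complModulus h0.le h1.le, thetaFour_inv hs, thetaThree_inv hs, mul_pow,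
      mul_pow, hss, thetaModulus]
    field_simp

theorem isSingularModulus_thetaModulus {r : ℝ} (hr : 0 < r) :
    IsSingularModulus r (thetaModulus √r) := by
  have hs := sqrt_pos.mpr hr
  refine ⟨thetaModulus_pos hs, thetaModulus_lt_one hs, ?_⟩
  have h : 0 < ellipticK (thetaModulus √r) := by
    rw [ellipticK_thetaModulus hs]; exact mul_pos (by positivity) (pow_pos (thetaThree_pos hs) 2)
  rw [ellipticK_complModulus_thetaModulus hs, mul_div_cancel_right₀ _ h.ne']

/-! ### Monotonicity of K and uniqueness of the singular modulus. -/

theorem one_sub_sq_mul_sin_sq_pos {k : ℝ} (h0 : 0 ≤ k) (h1 : k < 1) (t : ℝ) :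
    0 < 1 - k ^ 2 * sin t ^ 2 := by
  nlinarith [mul_le_of_le_one_right (sq_nonneg k) (sin_sq_le_one t)]

theorem ellipticK_lt {k l : ℝ} (hk : 0 ≤ k) (hkl : k < l) (hl : l < 1) :
    ellipticK k < ellipticK l := by
  have hc : ∀ m : ℝ, 0 ≤ m → m < 1 →
      ContinuousOn (fun t => 1 / √(1 - m ^ 2 * sin t ^ 2)) (Icc 0 (π / 2)) := fun m h0 h1 =>
    (continuous_const.div (by fun_prop) fun t =>
      (sqrt_pos.mpr (one_sub_sq_mul_sin_sq_pos h0 h1 t)).ne').continuousOn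
  have hsq : k ^ 2 < l ^ 2 := by gcongr
  have hl0 := hk.trans hkl.le
  -- The integrands agree at t = 0; strictness is witnessed at t = π/2, where sin t = 1.
  refine intervalIntegral.integral_lt_integral_of_continuousOn_of_le_of_exists_lt (by positivity)
    (hc k hk (hkl.trans hl)) (hc l hl0 hl) (fun t _ => ?_) ⟨π / 2, ⟨by positivity, le_rfl⟩, ?_⟩
  · refine one_div_le_one_div_of_le (sqrt_pos.mpr (one_sub_sq_mul_sin_sq_pos hl0 hl t))
      (sqrt_le_sqrt ?_)
    nlinarith [sq_nonneg (sin t)]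
  · refine one_div_lt_one_div_of_lt (sqrt_pos.mpr (one_sub_sq_mul_sin_sq_pos hl0 hl _))
      (sqrt_lt_sqrt (one_sub_sq_mul_sin_sq_pos hl0 hl _).le ?_)
    rw [sin_pi_div_two]; linarith

theorem ellipticK_pos {k : ℝ} (h0 : 0 ≤ k) (h1 : k < 1) : 0 < ellipticK k :=
  intervalIntegral.intervalIntegral_pos_of_pos
    ((continuous_const.div (by fun_prop) fun t =>
      (sqrt_pos.mpr (one_sub_sq_mul_sin_sq_pos h0 h1 t)).ne').intervalIntegrable _ _)
    (fun t => one_div_pos.mpr (sqrt_pos.mpr (one_sub_sq_mul_sin_sq_pos h0 h1 t))) (by positivity)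

theorem ellipticK_ratio_lt {k l : ℝ} (hk : 0 < k) (hkl : k < l) (hl : l < 1) :
    ellipticK (complModulus l) / ellipticK l < ellipticK (complModulus k) / ellipticK k := by
  have h1 : complModulus l < complModulus k := sqrt_lt_sqrt (by nlinarith) (by nlinarith)
  have h2 : complModulus k < 1 := by
    rw [complModulus, sqrt_lt' one_pos]; nlinarith
  exact div_lt_div₀ (ellipticK_lt (sqrt_nonneg _) h1 h2) (ellipticK_lt hk.le hkl hl).le
    (ellipticK_pos (sqrt_nonneg _) h2).le (ellipticK_pos hk.le (hkl.trans hl))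

theorem IsSingularModulus.unique {r k l : ℝ} (hk : IsSingularModulus r k)
    (hl : IsSingularModulus r l) : k = l := by
  rcases lt_trichotomy k l with h | h | h
  · exact absurd (hl.2.2.trans hk.2.2.symm) (ellipticK_ratio_lt hk.1 h hl.2.1).ne
  · exact h
  · exact absurd (hk.2.2.trans hl.2.2.symm) (ellipticK_ratio_lt hl.1 h hk.2.1).ne

end EllipticIntegral

/-! ### Finite triple product, Jacobi's cube identity, and the Lambert series of θ₄². -/

section LambertSeries

open Real Filter Topology Finset

/-- The finite Euler product `(1 - q)(1 - q²)⋯(1 - qⁿ)`. -/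
noncomputable def qFactorial (q : ℝ) (n : ℕ) : ℝ := ∏ k ∈ range n, (1 - q ^ (k + 1))

theorem qFactorial_succ (q : ℝ) (n : ℕ) :
    qFactorial q (n + 1) = qFactorial q n * (1 - q ^ (n + 1)) := prod_range_succ _ _

theorem one_sub_pow_pos {q : ℝ} (h0 : 0 < q) (h1 : q < 1) (n : ℕ) : 0 < 1 - q ^ (n + 1) :=
  sub_pos.mpr (pow_lt_one₀ h0.le h1 n.succ_ne_zero)

theorem qFactorial_pos {q : ℝ} (h0 : 0 < q) (h1 : q < 1) (n : ℕ) : 0 < qFactorial q n :=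
  prod_pos fun k _ => one_sub_pow_pos h0 h1 k

theorem qFactorial_antitone {q : ℝ} (h0 : 0 < q) (h1 : q < 1) : Antitone (qFactorial q) :=
  antitone_nat_of_succ_le fun n => by
    rw [qFactorial_succ]
    exact mul_le_of_le_one_right (qFactorial_pos h0 h1 n).le (by linarith [pow_pos h0 (n + 1)])

/-- The Euler product `∏ (1 - qⁿ)`. -/
noncomputable def eulerProduct (q : ℝ) : ℝ := ∏' n : ℕ, (1 - q ^ (n + 1))

theorem summable_pow_succ {q : ℝ} (h0 : 0 < q) (h1 : q < 1) :
    Summable fun n : ℕ => q ^ (n + 1) :=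
  (summable_nat_add_iff 1).mpr (summable_geometric_of_lt_one h0.le h1)

theorem tendsto_qFactorial {q : ℝ} (h0 : 0 < q) (h1 : q < 1) :
    Tendsto (qFactorial q) atTop (𝓝 (eulerProduct q)) := by
  have h : Multipliable fun n : ℕ => 1 + -q ^ (n + 1) :=
    multipliable_one_add_of_summable (by simpa using (summable_pow_succ h0 h1).norm)
  have h' := h.hasProd.tendsto_prod_nat
  simp only [← sub_eq_add_neg] at h'
  exact h'

theorem eulerProduct_le {q : ℝ} (h0 : 0 < q) (h1 : q < 1) (n : ℕ) :
    eulerProduct q ≤ qFactorial q n :=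
  (qFactorial_antitone h0 h1).le_of_tendsto (tendsto_qFactorial h0 h1) n

theorem eulerProduct_pos {q : ℝ} (h0 : 0 < q) (h1 : q < 1) : 0 < eulerProduct q := by
  have h : ∏' n : ℕ, (1 + -q ^ (n + 1)) ≠ 0 :=
    tprod_one_add_ne_zero_of_summable (fun n => by
      rw [← sub_eq_add_neg]; exact (one_sub_pow_pos h0 h1 n).ne')
      (by simpa using (summable_pow_succ h0 h1).norm)
  simp only [← sub_eq_add_neg] at h
  exact lt_of_le_of_ne (ge_of_tendsto' (tendsto_qFactorial h0 h1)
    fun n => (qFactorial_pos h0 h1 n).le) (Ne.symm h)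

/-- The `q`-binomial theorem at `q = p²`. -/
theorem prod_one_add_mul_pow {p : ℝ} (h0 : 0 < p) (h1 : p < 1) (x : ℝ) (N : ℕ) :
    ∏ k ∈ range N, (1 + x * (p ^ 2) ^ k) = ∑ j ∈ range (N + 1), p ^ (j * (j - 1)) *
      (qFactorial (p ^ 2) N / (qFactorial (p ^ 2) j * qFactorial (p ^ 2) (N - j))) * x ^ j := by
  have hq0 : 0 < p ^ 2 := by positivity
  have hq1 : p ^ 2 < 1 := pow_lt_one₀ h0.le h1 two_ne_zero
  have hF := fun n => (qFactorial_pos hq0 hq1 n).ne'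
  have h00 : qFactorial (p ^ 2) 0 = 1 := prod_range_zero _
  induction N with
  | zero => simp [h00]
  | succ N ih =>
    -- The q-Pascal rule, with q = p² so that q^(j(j-1)/2) needs no halving. The case j = N is
    -- excluded: there N - (j + 1) truncates to 0 and the first summand would not vanish.
    have hpas : ∀ j ∈ range N, p ^ ((j + 1) * (j + 1 - 1)) *
        (qFactorial (p ^ 2) (N + 1) /
          (qFactorial (p ^ 2) (j + 1) * qFactorial (p ^ 2) (N + 1 - (j + 1)))) * x ^ (j + 1) =
        p ^ ((j + 1) * (j + 1 - 1)) * (qFactorial (p ^ 2) N /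
          (qFactorial (p ^ 2) (j + 1) * qFactorial (p ^ 2) (N - (j + 1)))) * x ^ (j + 1) +
        p ^ (j * (j - 1)) * (qFactorial (p ^ 2) N /
          (qFactorial (p ^ 2) j * qFactorial (p ^ 2) (N - j))) * x ^ j * (x * (p ^ 2) ^ N) := by
      intro j hj
      obtain ⟨d, rfl⟩ := Nat.exists_eq_add_of_lt (mem_range.mp hj)
      have e : p ^ ((j + 1) * (j + 1 - 1)) = p ^ (j * (j - 1)) * (p ^ 2) ^ j := by
        rw [← pow_mul, ← pow_add]
        congr 1
        cases j with
        | zero => rfl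
        | succ j => simp only [Nat.add_sub_cancel]; ring
      rw [e, show j + d + 1 + 1 - (j + 1) = d + 1 by omega, show j + d + 1 - (j + 1) = d by omega,
        show j + d + 1 - j = d + 1 by omega, qFactorial_succ _ (j + d + 1), qFactorial_succ _ j,
        qFactorial_succ _ d]
      have := hF j
      have := hF d
      have := (one_sub_pow_pos hq0 hq1 j).ne'
      have := (one_sub_pow_pos hq0 hq1 d).ne'
      field_simp
      ring
    rw [prod_range_succ, ih, mul_add, mul_one, sum_range_succ (n := N + 1),
      sum_range_succ' (n := N) (f := fun j => p ^ (j * (j - 1)) * (qFactorial (p ^ 2) (N + 1) /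
        (qFactorial (p ^ 2) j * qFactorial (p ^ 2) (N + 1 - j))) * x ^ j), sum_congr rfl hpas,
      sum_add_distrib, sum_mul]
    conv_lhs => rw [sum_range_succ', sum_range_succ _ N]
    have e : p ^ ((N + 1) * (N + 1 - 1)) = p ^ (N * (N - 1)) * (p ^ 2) ^ N := by
      rw [← pow_mul, ← pow_add]
      congr 1
      cases N with
      | zero => rfl
      | succ j => simp only [Nat.add_sub_cancel]; ring
    rw [e]
    simp only [Nat.sub_self, Nat.sub_zero, h00, mul_one, one_mul, pow_zero, zero_mul,
      div_self (hF _)]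
    ring

/-- The central Gaussian binomial coefficient `[2m, m + i]`, zero for `|i| > m`. -/
noncomputable def centralQBinom (q : ℝ) (m : ℕ) (i : ℤ) : ℝ :=
  if i ∈ Icc (-m : ℤ) m then
    qFactorial q (2 * m) / (qFactorial q (m + i).toNat * qFactorial q (m - i).toNat) else 0

/-- The q-binomial theorem with 2m factors and x = z p^(-2m). Reversing the first m factors and
extracting their leading terms produces the powers of z⁻¹; the index is recentred by j = i + m. -/
theorem finite_triple_product {p z : ℝ} (h0 : 0 < p) (h1 : p < 1) (hz : z ≠ 0) (m : ℕ) :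
    ∏ l ∈ range m, ((1 + z⁻¹ * p ^ (2 * l + 2)) * (1 + z * p ^ (2 * l))) =
      ∑ i ∈ Icc (-m : ℤ) m, z ^ i * p ^ (i * (i - 1)) * centralQBinom (p ^ 2) m i := by
  have hp := h0.ne'
  have hA : ∏ k ∈ range (m + m), (1 + z * (p ^ (2 * m))⁻¹ * (p ^ 2) ^ k) =
      z ^ m * (p ^ (m * (m + 1)))⁻¹ *
      ∏ l ∈ range m, ((1 + z⁻¹ * p ^ (2 * l + 2)) * (1 + z * p ^ (2 * l))) := by
    rw [prod_range_add, prod_mul_distrib, ← mul_assoc]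
    congr 1
    · rw [← prod_range_reflect]
      clear h1
      have : ∀ l ∈ range m, 1 + z * (p ^ (2 * m))⁻¹ * (p ^ 2) ^ (m - 1 - l) =
          z * (p ^ (2 * (l + 1)))⁻¹ * (1 + z⁻¹ * p ^ (2 * l + 2)) := by
        intro l hl
        obtain ⟨d, rfl⟩ := Nat.exists_eq_add_of_lt (mem_range.mp hl)
        rw [show l + d + 1 - 1 - l = d by omega]
        field_simp
        ring
      rw [prod_congr rfl this, prod_mul_distrib]
      congr 1
      clear this
      induction m with
      | zero => simp
      | succ m ih => rw [prod_range_succ, ih]; field_simp; ring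
    · refine prod_congr rfl fun l _ => ?_
      rw [← pow_mul, mul_add 2 m l, pow_add]
      field_simp
  have hB := prod_one_add_mul_pow h0 h1 (z * (p ^ (2 * m))⁻¹) (m + m)
  rw [hA] at hB
  have hC : ∏ l ∈ range m, ((1 + z⁻¹ * p ^ (2 * l + 2)) * (1 + z * p ^ (2 * l))) =
      (z ^ m)⁻¹ * p ^ (m * (m + 1)) * (z ^ m * (p ^ (m * (m + 1)))⁻¹ *
      ∏ l ∈ range m, ((1 + z⁻¹ * p ^ (2 * l + 2)) * (1 + z * p ^ (2 * l)))) := by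
    field_simp
  rw [hC, hB, mul_sum]
  refine sum_bij' (fun j _ => (j : ℤ) - m) (fun i _ => (i + m).toNat) ?_ ?_ ?_ ?_ ?_
  · intro j hj; simp only [mem_range, mem_Icc] at *; omega
  · intro i hi; simp only [mem_range, mem_Icc] at *; omega
  · intro j hj; simp
  · intro i hi; simp only [mem_Icc] at *; omega
  · intro j hj
    simp only [mem_range] at hj
    have hmem : (j : ℤ) - m ∈ Icc (-m : ℤ) m := by simp only [mem_Icc]; omega
    rw [centralQBinom, if_pos hmem, show ((m : ℤ) + (j - m)).toNat = j by omega,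
      show ((m : ℤ) - (j - m)).toNat = m + m - j by omega, two_mul m]
    have e1 : z ^ ((j : ℤ) - m) = z ^ j * (z ^ m)⁻¹ := by
      rw [zpow_sub₀ hz, zpow_natCast, zpow_natCast, div_eq_mul_inv]
    have e2 : p ^ (((j : ℤ) - m) * (j - m - 1)) =
        p ^ (j * (j - 1)) * p ^ (m * (m + 1)) * ((p ^ (2 * m))⁻¹) ^ j := by
      rw [inv_pow, ← pow_mul, ← zpow_natCast, ← zpow_natCast, ← zpow_natCast, ← zpow_neg,
        ← zpow_add₀ hp, ← zpow_add₀ hp]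
      congr 1
      cases j with
      | zero => push_cast; ring
      | succ j => push_cast [Nat.add_sub_cancel]; ring
    rw [e1, e2, mul_pow]
    ring

/-- Passes from finite to infinite identities by dominated convergence: each central coefficient
tends to 1/E and is at most 1/E², where E is the Euler product. -/
theorem tendsto_sum_centralQBinom {q : ℝ} (h0 : 0 < q) (h1 : q < 1) {a : ℤ → ℝ}
    (ha : Summable fun i => ‖a i‖) :
    Tendsto (fun m : ℕ => ∑ i ∈ Icc (-m : ℤ) m, a i * centralQBinom q m i) atTop
      (𝓝 ((∑' i, a i) / eulerProduct q)) := by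
  have hE := eulerProduct_pos h0 h1
  have hL := tendsto_qFactorial h0 h1
  have hsum : ∀ m : ℕ, ∑ i ∈ Icc (-m : ℤ) m, a i * centralQBinom q m i =
      ∑' i, a i * centralQBinom q m i := fun m =>
    (tsum_eq_sum fun i hi => by rw [centralQBinom, if_neg hi, mul_zero]).symm
  simp only [hsum]
  rw [div_eq_mul_inv, ← tsum_mul_right]
  refine tendsto_tsum_of_dominated_convergence (ha.mul_right (1 / (eulerProduct q) ^ 2))
    (fun i => ?_) (Eventually.of_forall fun m i => ?_)
  · refine Tendsto.const_mul _ ?_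
    have l1 : Tendsto (fun m : ℕ => qFactorial q (2 * m)) atTop (𝓝 (eulerProduct q)) :=
      hL.comp (tendsto_id.const_mul_atTop' two_pos)
    have l2 : ∀ i : ℤ, Tendsto (fun m : ℕ => qFactorial q (m + i).toNat) atTop
        (𝓝 (eulerProduct q)) := fun i => hL.comp (tendsto_atTop.mpr fun b => by
      filter_upwards [eventually_ge_atTop (b + i.natAbs)] with m hm
      omega)
    have l3 := l1.div ((l2 i).mul (l2 (-i))) (by positivity)
    rw [show eulerProduct q / (eulerProduct q * eulerProduct q) = (eulerProduct q)⁻¹ by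
      field_simp] at l3
    refine l3.congr' ?_
    filter_upwards [eventually_ge_atTop i.natAbs] with m hm
    rw [centralQBinom, if_pos (by simp only [mem_Icc]; omega)]
    rfl
  · rw [norm_mul]
    refine mul_le_mul_of_nonneg_left ?_ (norm_nonneg _)
    rw [centralQBinom]
    split_ifs
    · have hF := fun n => qFactorial_pos h0 h1 n
      rw [norm_of_nonneg (div_pos (hF _) (mul_pos (hF _) (hF _))).le, sq]
      refine div_le_div₀ zero_le_one ?_ (by positivity)
        (mul_le_mul (eulerProduct_le h0 h1 _) (eulerProduct_le h0 h1 _) hE.le (hF _).le)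
      simpa [qFactorial] using qFactorial_antitone h0 h1 (Nat.zero_le (2 * m))
    · rw [norm_zero]; positivity

theorem exp_zpow_eq (x : ℝ) (n : ℤ) : rexp x ^ n = rexp (n * x) := by
  rw [mul_comm, exp_mul, rpow_intCast]

theorem exp_neg_pi_mul_lt_one {s : ℝ} (hs : 0 < s) : rexp (-π * s) < 1 := by
  rw [exp_lt_one_iff]; nlinarith [mul_pos pi_pos hs]

theorem summable_pow_mul_zpow_mul_zpow {p z : ℝ} (h0 : 0 < p) (h1 : p < 1) (hz : z ≠ 0) (k : ℕ) :
    Summable fun i : ℤ => ‖(i : ℝ) ^ k * (z ^ i * p ^ (i * (i - 1)))‖ := by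
  have hT : 0 < -log p / π := div_pos (neg_pos.mpr (log_neg h0 h1)) pi_pos
  -- The term |z|^i p^(i(i-1)) is exp(i² log p + i(log |z| - log p)), which dictates both
  -- parameters.
  have h := summable_pow_mul_jacobiTheta₂_term_bound (|log |z| - log p| / (2 * π)) hT k
  refine Summable.of_nonneg_of_le (fun i => norm_nonneg _) (fun i => ?_) h
  rw [norm_mul, norm_mul, norm_pow, norm_eq_abs (i : ℝ), Int.cast_abs, norm_zpow, norm_zpow,
    norm_eq_abs z, norm_of_nonneg h0.le]
  refine mul_le_mul_of_nonneg_left ?_ (by positivity)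
  rw [← exp_log (abs_pos.mpr hz), ← exp_log h0, exp_zpow_eq, exp_zpow_eq, ← exp_add, log_exp,
    log_exp]
  apply exp_le_exp.mpr
  have h2 := (le_abs_self ((i : ℝ) * (log |z| - log p))).trans_eq (abs_mul _ _)
  have h3 := pi_ne_zero
  push_cast
  field_simp
  linarith

theorem hasDerivAt_sum_zpow (s : Finset ℤ) (c : ℤ → ℝ) {z : ℝ} (hz : z ≠ 0) :
    HasDerivAt (fun z => ∑ i ∈ s, z ^ i * c i) (∑ i ∈ s, i * z ^ (i - 1) * c i) z :=
  HasDerivAt.fun_sum fun i _ => (hasDerivAt_zpow i z (Or.inl hz)).mul_const _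

theorem hasDerivAt_finite_triple_product {p z : ℝ} (h0 : 0 < p) (h1 : p < 1) (hz : z ≠ 0) (m : ℕ) :
    HasDerivAt (fun z => ∏ l ∈ range m, ((1 + z⁻¹ * p ^ (2 * l + 2)) * (1 + z * p ^ (2 * l))))
      (∑ i ∈ Icc (-m : ℤ) m, i * z ^ (i - 1) * (p ^ (i * (i - 1)) * centralQBinom (p ^ 2) m i))
      z := by
  refine (hasDerivAt_sum_zpow _ _ hz).congr_of_eventuallyEq ?_
  filter_upwards [isOpen_ne.mem_nhds hz] with w hw
  rw [finite_triple_product h0 h1 hw]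
  exact sum_congr rfl fun i _ => mul_assoc _ _ _

/-- Apply z d/dz to the finite triple product; z > 0 keeps every factor nonzero, so the logarithmic
derivative is available. -/
theorem finite_triple_product_logDeriv {p z : ℝ} (h0 : 0 < p) (h1 : p < 1) (hz : 0 < z) (m : ℕ) :
    (∏ l ∈ range m, ((1 + z⁻¹ * p ^ (2 * l + 2)) * (1 + z * p ^ (2 * l)))) *
      ∑ l ∈ range m, (z * p ^ (2 * l) / (1 + z * p ^ (2 * l)) -
        z⁻¹ * p ^ (2 * l + 2) / (1 + z⁻¹ * p ^ (2 * l + 2))) =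
      ∑ i ∈ Icc (-m : ℤ) m, i * (z ^ i * p ^ (i * (i - 1))) * centralQBinom (p ^ 2) m i := by
  have hd : HasDerivAt
      (fun z => ∏ l ∈ range m, ((1 + z⁻¹ * p ^ (2 * l + 2)) * (1 + z * p ^ (2 * l))))
      ((∏ l ∈ range m, ((1 + z⁻¹ * p ^ (2 * l + 2)) * (1 + z * p ^ (2 * l)))) *
        (∑ l ∈ range m, (z * p ^ (2 * l) / (1 + z * p ^ (2 * l)) -
        z⁻¹ * p ^ (2 * l + 2) / (1 + z⁻¹ * p ^ (2 * l + 2)))) / z) z := by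
    induction m with
    | zero => simpa using hasDerivAt_const z (1 : ℝ)
    | succ m ih =>
      simp only [prod_range_succ, sum_range_succ]
      have e1 := ((hasDerivAt_inv hz.ne').mul_const (p ^ (2 * m + 2))).const_add 1
      have e2 := ((hasDerivAt_id z).mul_const (p ^ (2 * m))).const_add 1
      refine (ih.mul (e1.mul e2)).congr_deriv ?_
      have : 1 + z * p ^ (2 * m) ≠ 0 := by positivity
      have : 1 + z⁻¹ * p ^ (2 * m + 2) ≠ 0 := by positivity
      have : z + p ^ (2 * m + 2) ≠ 0 := by positivity
      simp only [Pi.mul_apply, id]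
      generalize ∏ l ∈ range m, ((1 + z⁻¹ * p ^ (2 * l + 2)) * (1 + z * p ^ (2 * l))) = A
      generalize ∑ l ∈ range m, (z * p ^ (2 * l) / (1 + z * p ^ (2 * l)) -
        z⁻¹ * p ^ (2 * l + 2) / (1 + z⁻¹ * p ^ (2 * l + 2))) = B
      field_simp
      ring
  have h := hd.unique (hasDerivAt_finite_triple_product h0 h1 hz.ne' m)
  rw [div_eq_iff hz.ne'] at h
  rw [h, sum_mul]
  refine sum_congr rfl fun i _ => ?_
  rw [zpow_sub_one₀ hz.ne']
  field_simp

/-- At z = -1 the factor 1 + z (from l = 0) vanishes, so the derivative of the product is the value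
there of the remaining factors. -/
theorem finite_triple_product_deriv_neg_one {p : ℝ} (h0 : 0 < p) (h1 : p < 1) (n : ℕ) :
    qFactorial (p ^ 2) (n + 1) * qFactorial (p ^ 2) n =
      ∑ i ∈ Icc (-(n + 1 : ℕ) : ℤ) (n + 1 : ℕ),
        -(i * ((-1) ^ i * p ^ (i * (i - 1)))) * centralQBinom (p ^ 2) (n + 1) i := by
  have hz : (-1 : ℝ) ≠ 0 := by norm_num
  have h := hasDerivAt_finite_triple_product h0 h1 hz (n + 1)
  simp only [prod_range_succ', mul_zero, pow_zero, mul_one] at h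
  set G : ℝ → ℝ := fun z => (∏ l ∈ range n,
    ((1 + z⁻¹ * p ^ (2 * (l + 1) + 2)) * (1 + z * p ^ (2 * (l + 1))))) *
      (1 + z⁻¹ * p ^ (0 + 2)) with hG
  have hGd : DifferentiableAt ℝ G (-1) := by
    refine DifferentiableAt.mul (DifferentiableAt.fun_finsetProd fun l _ => ?_) ?_ <;>
      fun_prop (disch := norm_num)
  have h' := hGd.hasDerivAt.mul ((hasDerivAt_id (-1 : ℝ)).const_add 1)
  have hu := (h'.congr_of_eventuallyEq (Eventually.of_forall fun z => by
    simp only [hG, Pi.mul_apply, id]; ring)).unique h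
  simp only [id, mul_one, add_neg_cancel, mul_zero, zero_add] at hu
  have hG1 : G (-1) = qFactorial (p ^ 2) (n + 1) * qFactorial (p ^ 2) n := by
    rw [qFactorial, prod_range_succ', qFactorial, mul_right_comm, ← prod_mul_distrib, hG]
    simp only [← pow_mul]
    congr 1
    · refine prod_congr rfl fun l _ => ?_
      norm_num; ring
    · norm_num; ring
  rw [← hG1, hu]
  refine sum_congr rfl fun i _ => ?_
  rw [zpow_sub_one₀ hz]
  norm_num; ring

/-- Odd indices are written 1 - 2j because i(i - 1) takes the same value at i = 2j and i = 1 - 2j.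
-/
theorem tsum_even_add_odd_int {f : ℤ → ℝ} (hf : Summable f) :
    ∑' i, f i = ∑' j : ℤ, (f (2 * j) + f (1 - 2 * j)) := by
  let g : ℤ ⊕ ℤ → ℤ := Sum.elim (fun j => 2 * j) (fun j => 1 - 2 * j)
  have hg : Function.Bijective g := by
    constructor
    · rintro (a | a) (b | b) h <;> simp only [g, Sum.elim_inl, Sum.elim_inr] at h <;>
        simp only [Sum.inl.injEq, Sum.inr.injEq, reduceCtorEq] <;> omega
    · intro i
      rcases Int.even_or_odd' i with ⟨c, hc | hc⟩
      · exact ⟨Sum.inl c, hc.symm⟩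
      · exact ⟨Sum.inr (-c), by simp only [g, Sum.elim_inr]; omega⟩
  let e := Equiv.ofBijective g hg
  have h1 : Summable (f ∘ e) := e.summable_iff.mpr hf
  have hl := h1.comp_injective Sum.inl_injective
  have hr := h1.comp_injective Sum.inr_injective
  rw [← e.tsum_eq f]
  exact (Summable.tsum_sum (f := fun x => f (e x)) hl hr).trans (hl.tsum_add hr).symm

/-- Jacobi's series for the cube of the Euler product. -/
theorem tsum_eq_eulerProduct_cube {q : ℝ} (h0 : 0 < q) (h1 : q < 1) :
    ∑' j : ℤ, (1 - 4 * (j : ℝ)) * q ^ (j * (2 * j - 1)) = eulerProduct q ^ 3 := by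
  obtain ⟨p, hp0, rfl⟩ : ∃ p : ℝ, 0 < p ∧ p ^ 2 = q := ⟨√q, sqrt_pos.mpr h0, sq_sqrt h0.le⟩
  have hp1 : p < 1 := by nlinarith
  have hE := (eulerProduct_pos h0 h1).ne'
  have hs := summable_pow_mul_zpow_mul_zpow hp0 hp1 (show (-1 : ℝ) ≠ 0 by norm_num) 1
  simp only [pow_one] at hs
  have hs' : Summable fun i : ℤ => ‖-((i : ℝ) * ((-1) ^ i * p ^ (i * (i - 1))))‖ := by
    simpa only [norm_neg] using hs
  have hl := (tendsto_sum_centralQBinom h0 h1 hs').comp (tendsto_add_atTop_nat 1)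
  have hr := ((tendsto_qFactorial h0 h1).comp (tendsto_add_atTop_nat 1)).mul
    (tendsto_qFactorial h0 h1)
  have h := tendsto_nhds_unique (hr.congr fun n => finite_triple_product_deriv_neg_one hp0 hp1 n) hl
  -- The limit says E² = (series)/E. Pairing 2j with 1 - 2j adds the weights -2j and 1 - 2j to give
  -- 1 - 4j.
  rw [eq_div_iff hE, tsum_even_add_odd_int hs'.of_norm] at h
  rw [show eulerProduct (p ^ 2) ^ 3 = eulerProduct (p ^ 2) * eulerProduct (p ^ 2) *
    eulerProduct (p ^ 2) by ring, h]
  refine tsum_congr fun j => ?_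
  have e1 : (p ^ 2) ^ (j * (2 * j - 1)) = p ^ (2 * j * (2 * j - 1)) := by
    rw [← zpow_natCast, ← zpow_mul]; congr 1; push_cast; ring
  have e2 : (1 - 2 * j) * (1 - 2 * j - 1) = 2 * j * (2 * j - 1) := by ring
  have e3 : (-1 : ℝ) ^ (2 * j) = 1 := by rw [zpow_mul]; norm_num
  have e4 : (-1 : ℝ) ^ (1 - 2 * j) = -1 := by rw [zpow_sub₀ (by norm_num), e3]; norm_num
  rw [e1, e2, e3, e4]
  push_cast
  ring

/-- The finite product `(1 - q)(1 - q³)⋯(1 - q^(2m-1))`. -/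
noncomputable def qOddFactorial (q : ℝ) (m : ℕ) : ℝ := ∏ l ∈ range m, (1 - q ^ (2 * l + 1))

theorem qFactorial_two_mul (q : ℝ) (m : ℕ) :
    qFactorial q (2 * m) = qOddFactorial q m * qFactorial (q ^ 2) m := by
  induction m with
  | zero => simp [qFactorial, qOddFactorial]
  | succ m ih =>
    rw [mul_add_one, qFactorial_succ, qFactorial_succ, ih, qFactorial_succ, qOddFactorial,
      qOddFactorial, prod_range_succ]
    ring

theorem tendsto_qOddFactorial {q : ℝ} (h0 : 0 < q) (h1 : q < 1) :
    Tendsto (qOddFactorial q) atTop (𝓝 (eulerProduct q / eulerProduct (q ^ 2))) := by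
  have hq0 : 0 < q ^ 2 := by positivity
  have hq1 : q ^ 2 < 1 := pow_lt_one₀ h0.le h1 two_ne_zero
  refine (((tendsto_qFactorial h0 h1).comp (tendsto_id.const_mul_atTop' two_pos)).div
    (tendsto_qFactorial hq0 hq1) (eulerProduct_pos hq0 hq1).ne').congr fun m => ?_
  simp only [Pi.div_apply, Function.comp, id]
  rw [qFactorial_two_mul, mul_div_cancel_right₀ _ (qFactorial_pos hq0 hq1 m).ne']

/-- The triple product with p = q, z = -q, where both factors become 1 - q^(2l+1). -/
theorem tsum_alternating_sq_eq {q : ℝ} (h0 : 0 < q) (h1 : q < 1) :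
    ∑' i : ℤ, (-1 : ℝ) ^ i * q ^ (i ^ 2) = eulerProduct q ^ 2 / eulerProduct (q ^ 2) := by
  have hq0 : 0 < q ^ 2 := by positivity
  have hq1 : q ^ 2 < 1 := pow_lt_one₀ h0.le h1 two_ne_zero
  have hE := (eulerProduct_pos hq0 hq1).ne'
  have hs := summable_pow_mul_zpow_mul_zpow h0 h1 (neg_ne_zero.mpr h0.ne') 0
  simp only [pow_zero, one_mul] at hs
  have h := tendsto_nhds_unique (((tendsto_qOddFactorial h0 h1).pow 2).congr fun m => by
    rw [← finite_triple_product h0 h1 (neg_ne_zero.mpr h0.ne'), qOddFactorial, ← prod_pow]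
    refine prod_congr rfl fun l _ => ?_
    rw [inv_neg]
    field_simp
    ring) (tendsto_sum_centralQBinom hq0 hq1 hs)
  rw [eq_div_iff hE] at h
  rw [show eulerProduct q ^ 2 / eulerProduct (q ^ 2) =
    (eulerProduct q / eulerProduct (q ^ 2)) ^ 2 * eulerProduct (q ^ 2) by field_simp, h]
  refine tsum_congr fun i => ?_
  rw [neg_eq_neg_one_mul q, mul_zpow, mul_assoc, ← zpow_add₀ h0.ne']
  congr 2; ring

theorem summable_lambert {q : ℝ} (h0 : 0 < q) (h1 : q < 1) :
    Summable fun n : ℕ => (-1 : ℝ) ^ n * (q ^ (2 * n + 1) / (1 + q ^ (2 * n + 1))) := by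
  refine Summable.of_norm_bounded (summable_geometric_of_lt_one h0.le h1) fun n => ?_
  rw [norm_mul, norm_pow, norm_neg, norm_one, one_pow, one_mul, norm_of_nonneg (by positivity)]
  refine (div_le_self (by positivity) (by linarith [pow_pos h0 (2 * n + 1)])).trans ?_
  exact pow_le_pow_of_le_one h0.le h1.le (by omega)

theorem prod_one_add_odd_mul (q : ℝ) (m : ℕ) :
    (∏ l ∈ range m, ((1 + q ^ (4 * l + 3)) * (1 + q ^ (4 * l + 1)))) * qOddFactorial q (2 * m) =
      qOddFactorial (q ^ 2) (2 * m) := by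
  simp only [qOddFactorial]
  induction m with
  | zero => simp
  | succ m ih =>
    rw [mul_add_one, prod_range_succ, prod_range_succ, prod_range_succ, prod_range_succ,
      prod_range_succ, ← ih]
    ring

/-- Take p = q², z = q. The logarithmic derivative gives exponents 4l + 1 a plus and 4l + 3 a minus,
hence the Lambert series L. With T = ∑ q^(i(2i-1)), the weighted sum ∑ i q^(i(2i-1)) is L T, so
Jacobi's cube identity reads T(1 - 4L) = E(q)³. Since T = E(q²)²/E(q), this gives 1 - 4L =
(E(q)²/E(q²))². -/
theorem tsum_alternating_sq_sq_eq_lambert {q : ℝ} (h0 : 0 < q) (h1 : q < 1) :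
    (∑' i : ℤ, (-1 : ℝ) ^ i * q ^ (i ^ 2)) ^ 2 =
      1 - 4 * ∑' n : ℕ, (-1 : ℝ) ^ n * (q ^ (2 * n + 1) / (1 + q ^ (2 * n + 1))) := by
  have hq0 : 0 < q ^ 2 := by positivity
  have hq1 : q ^ 2 < 1 := pow_lt_one₀ h0.le h1 two_ne_zero
  have hr0 : 0 < (q ^ 2) ^ 2 := by positivity
  have hr1 : (q ^ 2) ^ 2 < 1 := pow_lt_one₀ hq0.le hq1 two_ne_zero
  have hE1 := (eulerProduct_pos h0 h1).ne'
  have hE2 := (eulerProduct_pos hq0 hq1).ne'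
  have hE4 := (eulerProduct_pos hr0 hr1).ne'
  set R : ℕ → ℝ := fun m => ∏ l ∈ range m, ((1 + q ^ (4 * l + 3)) * (1 + q ^ (4 * l + 1))) with hR
  set L := ∑' n : ℕ, (-1 : ℝ) ^ n * (q ^ (2 * n + 1) / (1 + q ^ (2 * n + 1))) with hL
  have hRe : ∀ m, ∏ l ∈ range m, ((1 + q⁻¹ * (q ^ 2) ^ (2 * l + 2)) * (1 + q * (q ^ 2) ^ (2 * l))) =
      R m := fun m => prod_congr rfl fun l _ => by field_simp; ring
  have htwo : Tendsto (fun m : ℕ => 2 * m) atTop atTop := tendsto_id.const_mul_atTop' two_pos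
  have hRlim : Tendsto R atTop (𝓝 (eulerProduct (q ^ 2) / eulerProduct ((q ^ 2) ^ 2) /
      (eulerProduct q / eulerProduct (q ^ 2)))) := by
    refine (((tendsto_qOddFactorial hq0 hq1).comp htwo).div
      ((tendsto_qOddFactorial h0 h1).comp htwo) (div_ne_zero hE1 hE2)).congr fun m => ?_
    simp only [Pi.div_apply, Function.comp]
    rw [← prod_one_add_odd_mul, mul_div_cancel_right₀]
    exact (prod_pos fun l _ => one_sub_pow_pos h0 h1 (2 * l)).ne'
  have hLlim : Tendsto (fun m : ℕ => ∑ l ∈ range m,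
      (q * (q ^ 2) ^ (2 * l) / (1 + q * (q ^ 2) ^ (2 * l)) -
        q⁻¹ * (q ^ 2) ^ (2 * l + 2) / (1 + q⁻¹ * (q ^ 2) ^ (2 * l + 2)))) atTop (𝓝 L) := by
    refine ((summable_lambert h0 h1).hasSum.tendsto_sum_nat.comp htwo).congr fun m => ?_
    simp only [Function.comp]
    induction m with
    | zero => simp
    | succ m ih =>
      rw [mul_add_one, sum_range_succ, sum_range_succ, ih, sum_range_succ, add_assoc]
      congr 1
      have e1 : q * (q ^ 2) ^ (2 * m) = q ^ (2 * (2 * m) + 1) := by ring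
      have e2 : q⁻¹ * (q ^ 2) ^ (2 * m + 2) = q ^ (2 * (2 * m + 1) + 1) := by field_simp; ring
      have e3 : (-1 : ℝ) ^ (2 * m) = 1 := by rw [pow_mul]; norm_num
      rw [e1, e2, pow_succ (-1 : ℝ), e3]
      ring
  have hz := h0.ne'
  have hs0 := summable_pow_mul_zpow_mul_zpow hq0 hq1 hz 0
  have hs1 := summable_pow_mul_zpow_mul_zpow hq0 hq1 hz 1
  simp only [pow_zero, one_mul] at hs0
  simp only [pow_one] at hs1
  have hT0 := tendsto_nhds_unique (hRlim.congr fun m => by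
    rw [← hRe, finite_triple_product hq0 hq1 hz]) (tendsto_sum_centralQBinom hr0 hr1 hs0)
  have hT1 := tendsto_nhds_unique ((hRlim.mul hLlim).congr fun m => by
    rw [← hRe, finite_triple_product_logDeriv hq0 hq1 h0]) (tendsto_sum_centralQBinom hr0 hr1 hs1)
  have hS := tsum_eq_eulerProduct_cube h0 h1
  have hS' : ∑' j : ℤ, (1 - 4 * (j : ℝ)) * q ^ (j * (2 * j - 1)) =
      ∑' i : ℤ, q ^ i * (q ^ 2) ^ (i * (i - 1)) -
        4 * ∑' i : ℤ, (i : ℝ) * (q ^ i * (q ^ 2) ^ (i * (i - 1))) := by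
    rw [← tsum_mul_left, ← hs0.of_norm.tsum_sub (hs1.of_norm.mul_left 4)]
    refine tsum_congr fun i => ?_
    have : q ^ (i * (2 * i - 1)) = q ^ i * (q ^ 2) ^ (i * (i - 1)) := by
      rw [← zpow_natCast q 2, ← zpow_mul, ← zpow_add₀ hz]; congr 1; push_cast; ring
    rw [this]; ring
  rw [eq_div_iff hE4] at hT0 hT1
  rw [hS', ← hT0, ← hT1] at hS
  rw [tsum_alternating_sq_eq h0 h1]
  have hE4' : eulerProduct (q ^ 4) ≠ 0 := by rwa [← pow_mul] at hE4
  field_simp at hS ⊢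
  linarith

theorem thetaFour_sq_eq_lambert {s : ℝ} (hs : 0 < s) :
    thetaFour s ^ 2 = 1 - 4 * ∑' n : ℕ, (-1 : ℝ) ^ n *
      (rexp (-π * s) ^ (2 * n + 1) / (1 + rexp (-π * s) ^ (2 * n + 1))) := by
  rw [← tsum_alternating_sq_sq_eq_lambert (exp_pos _)
    (exp_neg_pi_mul_lt_one hs), thetaFour]
  congr 1
  refine tsum_congr fun i => ?_
  rw [exp_zpow_eq]
  congr 2; push_cast; ring

theorem hasSum_lambert {s : ℝ} (hs : 0 < s) :
    HasSum (fun n : ℕ => (-1 : ℝ) ^ n / (rexp ((2 * (n : ℝ) + 1) * π * s) + 1))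
      ((1 - thetaFour s ^ 2) / 4) := by
  have h := (summable_lambert (exp_pos (-π * s))
    (exp_neg_pi_mul_lt_one hs)).hasSum
  rw [show (1 - thetaFour s ^ 2) / 4 = ∑' n : ℕ, (-1 : ℝ) ^ n *
      (rexp (-π * s) ^ (2 * n + 1) / (1 + rexp (-π * s) ^ (2 * n + 1))) by
    rw [thetaFour_sq_eq_lambert hs]; ring]
  convert h using 2 with n
  rw [← exp_nat_mul, show ((2 * n + 1 : ℕ) : ℝ) * (-π * s) = -((2 * (n : ℝ) + 1) * π * s) by
    push_cast; ring, exp_neg]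
  have := exp_pos ((2 * (n : ℝ) + 1) * π * s)
  field_simp

end LambertSeries

/-- `HasSum` in ℝ is unconditional, hence absolute, convergence. By uniqueness k is `thetaModulus
√r`, and θ₃² cancels in K k'. -/
theorem theorem6 (r : ℝ) (hr : 0 < r) :
    (∃! k : ℝ, IsSingularModulus r k) ∧
      ∀ k : ℝ, IsSingularModulus r k →
        HasSum
          (fun n : ℕ => (-1 : ℝ) ^ n /
            (Real.exp ((2 * (n : ℝ) + 1) * Real.pi * Real.sqrt r) + 1))
          (1 / 4 - ellipticK k * complModulus k / (2 * Real.pi)) := by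
  have h := isSingularModulus_thetaModulus hr
  refine ⟨⟨_, h, fun l hl => hl.unique h⟩, fun k hk => ?_⟩
  have hs := Real.sqrt_pos.mpr hr
  rw [hk.unique h, ellipticK_thetaModulus hs, complModulus_thetaModulus hs]
  convert hasSum_lambert hs using 1
  have := (thetaThree_pos hs).ne'
  have := Real.pi_ne_zero
  field_simp
  ring
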